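/- Let $M$ be a nonempty open subset of $\mathbb{R}$ or of $\mathbb{C}$ with coordinate $z$, and write $\partial=d/dz$. Differential operators on $M$ have smooth complex-valued coefficients (holomorphic ones if $M\subset\mathbb C$) and act on smooth (holomorphic) functions $M\to\mathbb C$. Let $\mathcal P_n$ be the space of complex polynomials in $z$ of degree at most $n$, let $n\ge m\ge 0$ be integers, $\Delta=n-m$, and $\mathcal P_{m,n}=\mathcal P_m\oplus\mathcal P_n$. Put $$J_n^+=z^2\partial-nz,\qquad J_n^0=z\partial-\tfrac n2,\qquad J^-_n=J^-=\partial ,$$ $$T^\epsilon=\begin{pmatrix}J_m^\epsilon&0\\0&J_n^\epsilon\end{pmatrix}\ (\epsilon=+,0,-),\qquad J=\frac12\begin{pmatrix}n+\Delta&0\\0&n\end{pmatrix},\qquad \tilde J=\begin{pmatrix}1&0\\0&-1\end{pmatrix},$$ and, for $\alpha=0,\dots,\Delta$, $$Q_\alpha=\begin{pmatrix}0&0\\z^\alpha&0\end{pmatrix},\qquad \overline Q_\alpha=\begin{pmatrix}0&q_\alpha\\0&0\end{pmatrix},\qquad q_\alpha=\Big(\prod_{j=1}^{\Delta-\alpha}(z\partial-n+\Delta-j)\Big)\partial^\alpha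 ,$$ an empty product being $1$. Here $p_d(T^\epsilon)$, $\tilde p_d(T^\epsilon)$, etc. denote (noncommutative) polynomials of degree at most $d$ in $T^+,T^0,T^-$ with complex coefficients. For a $2\times2$ matrix differential operator $A$ and an integer $k\ge 0$ consider the following property. $(\mathrm N_k)$: $A$ is a polynomial in the operators $T^\epsilon,J,Q_\alpha,\overline Q_\alpha$; moreover, if $k\ge\Delta$, there are polynomials such that $$A=p_k(T^\epsilon)+J\,\tilde p_k(T^\epsilon)+\sum_{\alpha=0}^{\Delta}\overline Q_\alpha\,\bar p^{\,\alpha}_{k-\Delta}(T^\epsilon)+\sum_{\alpha=0}^{\Delta}Q_\alpha\,p_k^\alpha(T^\epsilon),$$ where $J$ is replaced by $\tilde J$ if $\Delta=0$; if $k<\Delta$, then $A$ has this form with the $\overline Q$ sum absent, and in every representation of $A$ in the form $p(T^\epsilon)+J\tilde p(T^\epsilon)+\sum_\alpha\overline Q_\alpha\bar p^{\,\alpha}(T^\epsilon)+\sum_\alpha Q_\alpha p^\alpha(T^\epsilon)$ with polynomials of any degrees the $\overline Q$ sum is the zero operator. Theorem. Let $T^{(k)}$ be a $2\times2$ matrix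 linear differential operator of order at most $k$ that maps $\mathcal P_{m,n}$ into itself. (i) If $m\ge k$, then $T^{(k)}$ has property $(\mathrm N_k)$. (ii) If $n\ge k>m$, then $T^{(k)}=T\,\partial^{m+1}+\tilde T$ with matrix differential operators $$T=\begin{pmatrix}a&0\\c&0\end{pmatrix},\qquad \tilde T=\begin{pmatrix}\tilde a&\tilde b\\\tilde c&\tilde d\end{pmatrix},$$ where $a,c$ have order at most $k-m-1$, $\tilde a,\tilde c$ have order at most $m$, $\tilde b,\tilde d$ have order at most $k$, and $\tilde T$ preserves $\mathcal P_{m,n}$ and has property $(\mathrm N_k)$. (iii) If $k>n$, then $T^{(k)}=T\,\partial^{n+1}+\tilde T$, where $T$ is a $2\times 2$ matrix differential operator of order at most $k-n-1$ (of order exactly $k-n-1$ if $T^{(k)}$ has order exactly $k$), and $\tilde T$ is a $2\times2$ matrix differential operator of order at most $n$ that preserves $\mathcal P_{m,n}$ and satisfies the conclusion of (i) with $k$ replaced by $n$ if $m=n$, and the conclusion of (ii) with $k$ replaced by $n$ if $m<n$. -/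

import Mathlib

open scoped ContDiff

namespace PVSP

/-! ## Smooth functions on an open set

`𝕜` is the field of the independent variable (`ℝ` or `ℂ`), `M ⊆ 𝕜` is open, and all functions
are complex-valued. For `𝕜 = ℝ` the algebra below is `C^∞(M, ℂ)`, for `𝕜 = ℂ` it is the algebra of
holomorphic functions on `M`. -/

section Functions

variable {𝕜 : Type*} [RCLike 𝕜] [NormedAlgebra 𝕜 ℂ] (M : TopologicalSpace.Opens 𝕜)

/-- Extension of a function on `M` by zero. -/
noncomputable def extendZero (f : M → ℂ) : 𝕜 → ℂ :=
  Function.extend ((↑) : M → 𝕜) f 0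

theorem extendZero_coe (f : M → ℂ) (x : M) : extendZero M f x = f x :=
  Subtype.val_injective.extend_apply f 0 x

theorem contDiffOn_of_eq {f : M → ℂ} {g : 𝕜 → ℂ} (hg : ContDiffOn 𝕜 ∞ g M)
    (h : ∀ x : M, f x = g x) : ContDiffOn 𝕜 ∞ (extendZero M f) M :=
  hg.congr fun x hx => by
    rw [← h ⟨x, hx⟩]
    exact extendZero_coe M f ⟨x, hx⟩

/-- The algebra of smooth complex-valued functions on the open set `M`. -/
noncomputable def smoothFun : Subalgebra ℂ (M → ℂ) where
  carrier := {f | ContDiffOn 𝕜 ∞ (extendZero M f) M}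
  mul_mem' := fun {f g} hf hg =>
    contDiffOn_of_eq M (ContDiffOn.mul hf hg) fun x => by
      simp only [Pi.mul_apply, extendZero_coe]
  add_mem' := fun {f g} hf hg =>
    contDiffOn_of_eq M (ContDiffOn.add hf hg) fun x => by
      simp only [Pi.add_apply, extendZero_coe]
  algebraMap_mem' := fun c =>
    contDiffOn_of_eq M (g := fun _ => c) contDiffOn_const fun _ => rfl

theorem differentiableAt_extendZero (f : smoothFun M) (x : M) :
    DifferentiableAt 𝕜 (extendZero M (f : M → ℂ)) (x : 𝕜) :=
  (f.2.differentiableOn (by simp)).differentiableAt (M.isOpen.mem_nhds x.2)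

theorem extendZero_eventuallyEq {f : M → ℂ} {g : 𝕜 → ℂ} (h : ∀ x : M, f x = g x) (x : M) :
    extendZero M f =ᶠ[nhds (x : 𝕜)] g := by
  filter_upwards [M.isOpen.mem_nhds x.2] with y hy
  rw [← h ⟨y, hy⟩]
  exact extendZero_coe M f ⟨y, hy⟩

/-- The derivative `∂ = d/dz`, as a `ℂ`-linear operator on smooth functions. -/
noncomputable def D : Module.End ℂ (smoothFun M) where
  toFun f := ⟨fun x => deriv (extendZero M (f : M → ℂ)) x,
    contDiffOn_of_eq M (ContDiffOn.deriv_of_isOpen f.2 M.isOpen (by simp)) fun _ => rfl⟩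
  map_add' f g := by
    ext x
    have h := extendZero_eventuallyEq M (f := ((f + g : smoothFun M) : M → ℂ))
      (g := extendZero M (f : M → ℂ) + extendZero M (g : M → ℂ))
      (fun y => by simp [extendZero_coe]) x
    change deriv (extendZero M ((f + g : smoothFun M) : M → ℂ)) (x : 𝕜) = _
    rw [h.deriv_eq, deriv_add (differentiableAt_extendZero M f x)
      (differentiableAt_extendZero M g x)]
    rfl
  map_smul' c f := by
    ext x
    have h := extendZero_eventuallyEq M (f := ((c • f : smoothFun M) : M → ℂ))
      (g := fun y => c * extendZero M (f : M → ℂ) y)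
      (fun y => by simp [extendZero_coe]) x
    change deriv (extendZero M ((c • f : smoothFun M) : M → ℂ)) (x : 𝕜) = _
    rw [h.deriv_eq, deriv_const_mul c (differentiableAt_extendZero M f x)]
    rfl

/-- The coordinate function `z`. -/
noncomputable def z : smoothFun M :=
  ⟨fun x => algebraMap 𝕜 ℂ x,
    contDiffOn_of_eq M (g := algebraMapCLM 𝕜 ℂ)
      (algebraMapCLM 𝕜 ℂ).contDiff.contDiffOn fun _ => rfl⟩

/-- The operator of multiplication by a smooth function. -/
noncomputable def mulOp (f : smoothFun M) : Module.End ℂ (smoothFun M) :=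
  LinearMap.mulLeft ℂ f

/-- `P_n`: the (restrictions to `M` of) complex polynomials in `z` of degree at most `n`. -/
noncomputable def polySpace (n : ℕ) : Submodule ℂ (smoothFun M) :=
  (Polynomial.degreeLE ℂ (n : WithBot ℕ)).map (Polynomial.aeval (z M)).toLinearMap

/-! ## Differential operators -/

/-- `L` is a scalar differential operator of order less than `d`, that is
`L = ∑_{i < d} c_i(z) ∂^i` with smooth coefficients. -/
def OrderLT (d : ℕ) (L : Module.End ℂ (smoothFun M)) : Prop :=
  ∃ c : ℕ → smoothFun M, L = ∑ i ∈ Finset.range d, mulOp M (c i) * D M ^ i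

/-- `L` is a scalar differential operator of order at most `k`. -/
def OrderLE (k : ℕ) (L : Module.End ℂ (smoothFun M)) : Prop := OrderLT M (k + 1) L

/-- `2 × 2` matrices of operators; their product is composition. -/
noncomputable abbrev MatOp : Type _ := Matrix (Fin 2) (Fin 2) (Module.End ℂ (smoothFun M))

/-- `T` is a `2 × 2` matrix differential operator of order at most `k`. -/
def MatOrderLE (k : ℕ) (T : MatOp M) : Prop := ∀ i j, OrderLE M k (T i j)

/-- `T` is a `2 × 2` matrix differential operator of order exactly `k`. -/
def MatOrderEq (k : ℕ) (T : MatOp M) : Prop :=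
  MatOrderLE M k T ∧ ¬ ∀ i j, OrderLT M k (T i j)

/-- The action of a matrix of operators on vector-valued functions. -/
noncomputable def MatOp.act (T : MatOp M) (ψ : Fin 2 → smoothFun M) : Fin 2 → smoothFun M :=
  fun i => ∑ j, T i j (ψ j)

/-- `P_{m,n} = P_m ⊕ P_n`. -/
noncomputable def polyVecSpace (m n : ℕ) : Submodule ℂ (Fin 2 → smoothFun M) :=
  Submodule.pi Set.univ ![polySpace M m, polySpace M n]

/-- `T` maps `P_{m,n}` into itself. -/
def Preserves (m n : ℕ) (T : MatOp M) : Prop :=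
  ∀ ψ ∈ polyVecSpace M m n, T.act M ψ ∈ polyVecSpace M m n

/-- The matrix operator `∂^r` (times the identity matrix). -/
noncomputable def matD (r : ℕ) : MatOp M := Matrix.diagonal fun _ => D M ^ r

/-! ## The generators -/

/-- `J_n^+ = z² ∂ - n z`. -/
noncomputable def Jplus (n : ℕ) : Module.End ℂ (smoothFun M) :=
  mulOp M (z M ^ 2) * D M - (n : ℂ) • mulOp M (z M)

/-- `J_n^0 = z ∂ - n / 2`. -/
noncomputable def Jzero (n : ℕ) : Module.End ℂ (smoothFun M) :=
  mulOp M (z M) * D M - ((n : ℂ) / 2) • 1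

/-- `J^- = ∂`. -/
noncomputable def Jminus : Module.End ℂ (smoothFun M) := D M

/-- `q_α(n, Δ) = (∏_{k=1}^{Δ-α} (z ∂ - n + Δ - k)) ∂^α`. -/
noncomputable def qbar (n Δ α : ℕ) : Module.End ℂ (smoothFun M) :=
  ((List.range (Δ - α)).map fun i : ℕ =>
    mulOp M (z M) * D M + (-(n : ℂ) + (Δ : ℂ) - ((i : ℂ) + 1)) • 1).prod * D M ^ α

/-- `T^ε`, for `ε = +, 0, -` in this order, acting on `P_{m,n}`. -/
noncomputable def Tgen (m n : ℕ) : Fin 3 → MatOp M :=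
  ![!![Jplus M m, 0; 0, Jplus M n],
    !![Jzero M m, 0; 0, Jzero M n],
    !![Jminus M, 0; 0, Jminus M]]

/-- `J = (1/2) diag(n + Δ, n)`, where `Δ = n - m`. -/
noncomputable def Jop (m n : ℕ) : MatOp M :=
  !![(((n : ℂ) + ((n - m : ℕ) : ℂ)) / 2) • 1, 0; 0, ((n : ℂ) / 2) • 1]

/-- `J̃ = σ₃ = diag(1, -1)`. -/
noncomputable def sigma3 : MatOp M := !![1, 0; 0, -1]

/-- `Q_α = z^α σ^-`. -/
noncomputable def Q (α : ℕ) : MatOp M := !![0, 0; mulOp M (z M ^ α), 0]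

/-- `Q̄_α = q_α(n, Δ) σ^+`, where `Δ = n - m`. -/
noncomputable def Qbar (m n α : ℕ) : MatOp M := !![0, qbar M n (n - m) α; 0, 0]

/-- The set of all the operators `T^+, T^0, T^-, J, Q_α, Q̄_α`, `0 ≤ α ≤ Δ = n - m`. -/
noncomputable def generators (m n : ℕ) : Set (MatOp M) :=
  Set.range (Tgen M m n) ∪ {Jop M m n} ∪ {A | ∃ α ≤ n - m, A = Q M α} ∪
    {A | ∃ α ≤ n - m, A = Qbar M m n α}

/-! ## Polynomials in the `T^ε` and the normal form -/

/-- Noncommutative polynomials in three letters of degree at most `d`: the span of the words of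
length at most `d`. -/
noncomputable def ncPoly (d : ℕ) : Submodule ℂ (FreeAlgebra ℂ (Fin 3)) :=
  Submodule.span ℂ {w | ∃ l : List (Fin 3), l.length ≤ d ∧ w = (l.map (FreeAlgebra.ι ℂ)).prod}

/-- `p(T^ε)`: the value of the polynomial `p` at `T^+, T^0, T^-`. -/
noncomputable def evalT (m n : ℕ) (p : FreeAlgebra ℂ (Fin 3)) : MatOp M :=
  FreeAlgebra.lift ℂ (Tgen M m n) p

/-- The operator `J`, replaced by `J̃ = σ₃` when `Δ = n - m` is zero. -/
noncomputable def Jform (m n : ℕ) : MatOp M := if n = m then sigma3 M else Jop M m n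

/-- The part `p(T^ε) + J p̃(T^ε) + ∑_α Q_α q^α(T^ε)` of the normal form. -/
noncomputable def lowerForm (m n : ℕ) (p p₁ : FreeAlgebra ℂ (Fin 3))
    (q : ℕ → FreeAlgebra ℂ (Fin 3)) : MatOp M :=
  evalT M m n p + Jform M m n * evalT M m n p₁ +
    ∑ α ∈ Finset.range (n - m + 1), Q M α * evalT M m n (q α)

/-- The part `∑_α Q̄_α p̄^α(T^ε)` of the normal form. -/
noncomputable def upperForm (m n : ℕ) (r : ℕ → FreeAlgebra ℂ (Fin 3)) : MatOp M :=
  ∑ α ∈ Finset.range (n - m + 1), Qbar M m n α * evalT M m n (r α)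

/-- The conclusion of part (i) for the bound `k`: `T` is a polynomial in the generators, it has the
explicit normal form if `k ≥ Δ = n - m`, and if `k < Δ` it has the normal form without the `Q̄` part,
and the `Q̄` part of any representation of `T` in that form is zero. -/
def SatisfiesI (m n k : ℕ) (T : MatOp M) : Prop :=
  T ∈ Algebra.adjoin ℂ (generators M m n) ∧
  (n - m ≤ k → ∃ p ∈ ncPoly k, ∃ p₁ ∈ ncPoly k, ∃ r q : ℕ → FreeAlgebra ℂ (Fin 3),
    (∀ α, r α ∈ ncPoly (k - (n - m))) ∧ (∀ α, q α ∈ ncPoly k) ∧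
    T = lowerForm M m n p p₁ q + upperForm M m n r) ∧
  (k < n - m →
    (∃ p ∈ ncPoly k, ∃ p₁ ∈ ncPoly k, ∃ q : ℕ → FreeAlgebra ℂ (Fin 3),
      (∀ α, q α ∈ ncPoly k) ∧ T = lowerForm M m n p p₁ q) ∧
    (∀ (p p₁ : FreeAlgebra ℂ (Fin 3)) (r q : ℕ → FreeAlgebra ℂ (Fin 3)),
      T = lowerForm M m n p p₁ q + upperForm M m n r → upperForm M m n r = 0))

/-- The conclusion of part (ii) for the bound `k > m`: `T = S ∂^{m+1} + R`, where the second column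
of `S` is zero, the entries of the first column of `S` have order at most `k - m - 1`, those of the
first column of `R` order at most `m`, those of its second column order at most `k`, and `R`
preserves `P_{m,n}` and satisfies (i). -/
def SatisfiesII (m n k : ℕ) (T : MatOp M) : Prop :=
  ∃ S R : MatOp M, T = S * matD M (m + 1) + R ∧
    (∀ i, OrderLE M (k - m - 1) (S i 0)) ∧ (∀ i, S i 1 = 0) ∧
    (∀ i, OrderLE M m (R i 0)) ∧ (∀ i, OrderLE M k (R i 1)) ∧
    Preserves M m n R ∧ SatisfiesI M m n k R

end Functions

end PVSP

/-!
The four entries of a matrix operator that preserves `P_{m,n}` are scalar operators between `P_m`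
and `P_n`, so everything reduces to scalar differential operators `L : P_a → P_b` of order at most
`k ≤ a`. The coefficients of such an `L` can be solved for successively from `L 1, L z, …, L z^k`
and are therefore polynomials (`coeff_mem_of_apply_z_pow_mem`). Hence `L` is a sum of homogeneous
parts `z^j ↦ f_d(j) z^{j+d}` whose symbols `f_d` are polynomials of degree at most `k`
(`exists_symbols`), and `L` maps `P_a` into `P_b` exactly when every `f_d` vanishes at the
`j ∈ [0, a]` with `j + d ∉ [0, b]`. A differential operator is determined by its action on the
powers of `z` (`diffOps_ext`), so it suffices to realise each symbol separately
(`mem_of_exists_isShift`).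

Unless `f_d = 0`, its prescribed zeros are exactly the zeros of the symbol of a standard operator
of the same degree `d`: `∂^e` or `z^α (J_m^+)^e` for `P_m → P_n`
(`exists_eq_sum_mulOp_mul_evalJ`), and `q_0 (J_n^+)^e`, `q_α` or `q_Δ ∂^e` for `P_n → P_m`
(`exists_eq_sum_qbar_mul_evalJ`). The quotient of `f_d` by that symbol is a polynomial `g` whose
degree is at most `k` minus the number of zeros, and it is realised by `g(J^0 + n/2)`, since
`J^0 + n/2 = z∂` multiplies `z^j` by `j`. In the case `P_n → P_m` there are at least `Δ = n - m`
zeros: this lowers the degree bound to `k - Δ`, and it forces the operator to vanish when `k < Δ`.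

For equal degrees the first of these two results describes the diagonal entries. The two diagonal
polynomials are merged into `p(T) + J p̃(T)` because `J` has different scalar entries on the two
summands (`satisfiesI_of_preserves`). Orders exceeding `m` or `n` are removed by division with
remainder by a power of `∂` that annihilates `P_m` or `P_n` (`OrderLT.exists_eq_mul_D_pow_add`).
-/

namespace PVSP

open Polynomial

/-! ### The derivation and polynomials on `M` -/

section Functions

variable {𝕜 : Type*} [RCLike 𝕜] [NormedAlgebra 𝕜 ℂ] (M : TopologicalSpace.Opens 𝕜)

theorem D_mul (f g : smoothFun M) : D M (f * g) = f * D M g + g * D M f := by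
  ext x
  have h := extendZero_eventuallyEq M (f := ((f * g : smoothFun M) : M → ℂ))
    (g := extendZero M (f : M → ℂ) * extendZero M (g : M → ℂ))
    (fun y => by simp [extendZero_coe]) x
  change deriv (extendZero M ((f * g : smoothFun M) : M → ℂ)) (x : 𝕜) = _
  rw [h.deriv_eq, deriv_mul (differentiableAt_extendZero M f x)
    (differentiableAt_extendZero M g x), extendZero_coe, extendZero_coe,
    mul_comm (deriv _ _), add_comm]
  rfl

/-- `∂` as a derivation of the algebra of smooth functions. -/
noncomputable def derivD : Derivation ℂ (smoothFun M) (smoothFun M) :=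
  Derivation.mk' (D M) fun f g => D_mul M f g

theorem D_z : D M (z M) = 1 := by
  ext x
  have h := extendZero_eventuallyEq M (f := ((z M : smoothFun M) : M → ℂ))
    (g := algebraMapCLM 𝕜 ℂ) (fun y => rfl) x
  change deriv (extendZero M ((z M : smoothFun M) : M → ℂ)) (x : 𝕜) = _
  rw [h.deriv_eq, (algebraMapCLM 𝕜 ℂ).hasDerivAt.deriv]
  simp

theorem D_aeval (P : ℂ[X]) : D M (aeval (z M) P) = aeval (z M) (derivative P) := by
  have h := (derivD M).map_aeval P (z M)
  change D M _ = _ • D M _ at h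
  rw [h, D_z, smul_eq_mul, mul_one]

theorem D_pow_aeval (i : ℕ) (P : ℂ[X]) :
    (D M ^ i) (aeval (z M) P) = aeval (z M) (derivative^[i] P) := by
  induction i generalizing P with
  | zero => simp
  | succ i ih => rw [pow_succ, Module.End.mul_apply, D_aeval, ih, Function.iterate_succ_apply]

theorem D_pow_z_pow (i j : ℕ) :
    (D M ^ i) (z M ^ j) = (j.descFactorial i : ℂ) • z M ^ (j - i) := by
  have h := D_pow_aeval M i (X ^ j)
  rw [iterate_derivative_X_pow_eq_smul] at h
  simpa [Nat.cast_smul_eq_nsmul] using h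

@[simp] theorem mulOp_apply (f g : smoothFun M) : mulOp M f g = f * g := rfl

theorem z_pow_mem_polySpace {j n : ℕ} (h : j ≤ n) : z M ^ j ∈ polySpace M n :=
  ⟨X ^ j, mem_degreeLE.2 ((degree_X_pow_le j).trans (by exact_mod_cast h)), by simp⟩

theorem mem_polySpace {n : ℕ} {f : smoothFun M} :
    f ∈ polySpace M n ↔ ∃ P : ℂ[X], P.natDegree ≤ n ∧ aeval (z M) P = f := by
  simp only [polySpace, Submodule.mem_map, mem_degreeLE, natDegree_le_iff_degree_le]
  rfl

/-- A polynomial is determined by its restriction to `M`, since `M` is infinite. -/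
theorem aeval_z_injective (hM : (M : Set 𝕜).Nonempty) :
    Function.Injective (aeval (z M) : ℂ[X] → smoothFun M) := by
  obtain ⟨x, hx⟩ := hM
  have hinf : (M : Set 𝕜).Infinite := infinite_of_mem_nhds x (M.isOpen.mem_nhds hx)
  intro P Q h
  refine eq_of_infinite_eval_eq P Q
    ((hinf.image (algebraMap 𝕜 ℂ).injective.injOn).mono ?_)
  rintro _ ⟨y, hy, rfl⟩
  have h1 : ∀ R : ℂ[X], ((aeval (z M) R : smoothFun M) : M → ℂ) ⟨y, hy⟩
      = R.eval (algebraMap 𝕜 ℂ y) := by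
    intro R
    have := Polynomial.aeval_algHom_apply
      ((Pi.evalAlgHom ℂ (fun _ : M => ℂ) ⟨y, hy⟩).comp (smoothFun M).val) (z M) R
    simp only [AlgHom.comp_apply] at this
    change _ = aeval _ R
    exact this.symm
  change P.eval _ = Q.eval _
  rw [← h1, ← h1, h]

/-! ### Differential operators -/

variable {M}

theorem OrderLT.mono {d e : ℕ} (h : d ≤ e) {L : Module.End ℂ (smoothFun M)}
    (hL : OrderLT M d L) : OrderLT M e L := by
  obtain ⟨c, rfl⟩ := hL
  refine ⟨fun i => if i < d then c i else 0, ?_⟩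
  rw [← Finset.sum_subset (Finset.range_mono h)]
  · refine Finset.sum_congr rfl fun i hi => ?_
    simp only [if_pos (Finset.mem_range.1 hi)]
  · intro i _ hi
    simp only [if_neg (mt Finset.mem_range.2 hi)]
    ext f : 1
    simp

theorem OrderLT.add {d : ℕ} {L L' : Module.End ℂ (smoothFun M)}
    (hL : OrderLT M d L) (hL' : OrderLT M d L') : OrderLT M d (L + L') := by
  obtain ⟨c, rfl⟩ := hL
  obtain ⟨c', rfl⟩ := hL'
  refine ⟨c + c', ?_⟩
  rw [← Finset.sum_add_distrib]
  refine Finset.sum_congr rfl fun i _ => ?_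
  ext f : 1
  simp [add_mul]

theorem OrderLT.mulOp_mul {d : ℕ} {L : Module.End ℂ (smoothFun M)} (hL : OrderLT M d L)
    (f : smoothFun M) : OrderLT M d (mulOp M f * L) := by
  obtain ⟨c, rfl⟩ := hL
  refine ⟨fun i => f * c i, ?_⟩
  rw [Finset.mul_sum]
  refine Finset.sum_congr rfl fun i _ => ?_
  ext g : 1
  simp [mul_assoc]

theorem OrderLT.zero (d : ℕ) : OrderLT M d 0 := ⟨0, by
  refine (Finset.sum_eq_zero fun i _ => ?_).symm
  ext f : 1
  simp⟩

theorem OrderLT.sum {ι : Type*} {d : ℕ} (s : Finset ι) {L : ι → Module.End ℂ (smoothFun M)}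
    (hL : ∀ i ∈ s, OrderLT M d (L i)) : OrderLT M d (∑ i ∈ s, L i) :=
  Finset.sum_induction L (OrderLT M d) (fun _ _ => OrderLT.add) (OrderLT.zero d) hL

theorem orderLT_mulOp_mul_D_pow (f : smoothFun M) (i : ℕ) :
    OrderLT M (i + 1) (mulOp M f * D M ^ i) := by
  refine ⟨Pi.single i f, ?_⟩
  rw [Finset.sum_eq_single i]
  · simp
  · intro j _ hj
    rw [Pi.single_eq_of_ne hj]
    ext g : 1
    simp
  · simp

theorem OrderLT.D_mul {d : ℕ} {L : Module.End ℂ (smoothFun M)} (hL : OrderLT M d L) :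
    OrderLT M (d + 1) (D M * L) := by
  obtain ⟨c, rfl⟩ := hL
  rw [Finset.mul_sum]
  refine OrderLT.sum _ fun i hi => ?_
  have hi := Finset.mem_range.1 hi
  have h : D M * (mulOp M (c i) * D M ^ i)
      = mulOp M (c i) * D M ^ (i + 1) + mulOp M (D M (c i)) * D M ^ i := by
    ext f : 1
    simp [PVSP.D_mul, pow_succ', mul_comm]
  rw [h]
  exact ((orderLT_mulOp_mul_D_pow _ _).mono (by lia)).add
    ((orderLT_mulOp_mul_D_pow _ _).mono (by lia))

theorem OrderLT.D_pow_mul {d : ℕ} {L : Module.End ℂ (smoothFun M)} (hL : OrderLT M d L) (i : ℕ) :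
    OrderLT M (d + i) (D M ^ i * L) := by
  induction i with
  | zero => simpa using hL
  | succ i ih => rw [pow_succ', mul_assoc]; exact ih.D_mul

theorem OrderLT.mul {d e : ℕ} {L L' : Module.End ℂ (smoothFun M)}
    (hL : OrderLT M d L) (hL' : OrderLT M e L') : OrderLT M (e + d) (L * L') := by
  obtain ⟨c, rfl⟩ := hL
  rw [Finset.sum_mul]
  refine OrderLT.sum _ fun i hi => ?_
  have hi := Finset.mem_range.1 hi
  rw [mul_assoc]
  exact ((hL'.D_pow_mul i).mulOp_mul _).mono (by lia)

theorem OrderLT.mul_D_pow {d : ℕ} {L : Module.End ℂ (smoothFun M)} (hL : OrderLT M d L) (r : ℕ) :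
    OrderLT M (d + r) (L * D M ^ r) := by
  obtain ⟨c, rfl⟩ := hL
  rw [Finset.sum_mul]
  refine OrderLT.sum _ fun i hi => ?_
  have hi := Finset.mem_range.1 hi
  rw [mul_assoc, ← pow_add]
  exact (orderLT_mulOp_mul_D_pow _ _).mono (by lia)

variable (M) in
/-- The algebra of scalar differential operators of arbitrary order. -/
noncomputable def diffOps : Subalgebra ℂ (Module.End ℂ (smoothFun M)) where
  carrier := {L | ∃ d, OrderLT M d L}
  mul_mem' := fun ⟨_, h⟩ ⟨_, h'⟩ => ⟨_, h.mul h'⟩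
  add_mem' := fun ⟨d, h⟩ ⟨e, h'⟩ =>
    ⟨max d e, (h.mono (le_max_left d e)).add (h'.mono (le_max_right d e))⟩
  algebraMap_mem' := fun c => ⟨1, ⟨fun _ => algebraMap ℂ _ c, by
    ext f : 1
    simp [Algebra.smul_def]⟩⟩

theorem sub_mem_diffOps {L L' : Module.End ℂ (smoothFun M)} (hL : L ∈ diffOps M)
    (hL' : L' ∈ diffOps M) : L - L' ∈ diffOps M := by
  have h : L - L' = L + (-1 : ℂ) • L' := by
    ext f : 1
    simp [sub_eq_add_neg]
  exact h ▸ add_mem hL ((diffOps M).smul_mem hL' (-1))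

theorem mulOp_mem_diffOps (f : smoothFun M) : mulOp M f ∈ diffOps M :=
  ⟨1, by simpa using orderLT_mulOp_mul_D_pow f 0⟩

theorem D_mem_diffOps : D M ∈ diffOps M :=
  ⟨2, by
    have h := orderLT_mulOp_mul_D_pow (1 : smoothFun M) 1
    have h1 : mulOp M (1 : smoothFun M) = 1 := by ext f : 1; simp
    simpa [h1] using h⟩

/-- A differential operator applied to a power of `z`, in terms of its coefficients. -/
theorem sum_mulOp_apply_z_pow (c : ℕ → smoothFun M) (d j : ℕ) :
    (∑ i ∈ Finset.range d, mulOp M (c i) * D M ^ i) (z M ^ j)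
      = ∑ i ∈ Finset.range d, (j.descFactorial i : ℂ) • (c i * z M ^ (j - i)) := by
  rw [LinearMap.sum_apply]
  refine Finset.sum_congr rfl fun i _ => ?_
  rw [Module.End.mul_apply, D_pow_z_pow, mulOp_apply, mul_smul_comm]

/-- The coefficients of an operator can be recovered one after the other from its values on
`1, z, z², …`, so they lie in every subspace that contains these values and is stable under
multiplication by `z`. -/
theorem coeff_mem_of_apply_z_pow_mem (A : Submodule ℂ (smoothFun M))
    (hA : ∀ f ∈ A, f * z M ∈ A) (c : ℕ → smoothFun M) (d : ℕ)
    (h : ∀ j < d, (∑ i ∈ Finset.range d, mulOp M (c i) * D M ^ i) (z M ^ j) ∈ A) :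
    ∀ j < d, c j ∈ A := by
  have hA' : ∀ f ∈ A, ∀ e : ℕ, f * z M ^ e ∈ A := by
    intro f hf e
    induction e with
    | zero => simpa using hf
    | succ e ih => rw [pow_succ, ← mul_assoc]; exact hA _ ih
  intro j
  induction j using Nat.strong_induction_on with
  | _ j ih =>
    intro hj
    have hs := h j hj
    rw [sum_mulOp_apply_z_pow, ← Finset.add_sum_erase _ _ (Finset.mem_range.2 hj)] at hs
    have hrest : ∑ i ∈ (Finset.range d).erase j,
        (j.descFactorial i : ℂ) • (c i * z M ^ (j - i)) ∈ A := by
      refine Submodule.sum_mem _ fun i hi => ?_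
      rw [Finset.mem_erase, Finset.mem_range] at hi
      rcases lt_or_gt_of_ne hi.1 with hij | hij
      · exact A.smul_mem _ (hA' _ (ih i hij hi.2) _)
      · rw [Nat.descFactorial_of_lt hij]
        simp
    have h1 := (Submodule.add_mem_iff_left _ hrest).1 hs
    rw [Nat.descFactorial_self, Nat.sub_self, pow_zero, mul_one] at h1
    exact (A.smul_mem_iff (by exact_mod_cast j.factorial_ne_zero)).1 h1

theorem eq_zero_of_apply_z_pow {L : Module.End ℂ (smoothFun M)} (hL : L ∈ diffOps M)
    (h : ∀ j : ℕ, L (z M ^ j) = 0) : L = 0 := by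
  obtain ⟨d, c, rfl⟩ := hL
  have hc := coeff_mem_of_apply_z_pow_mem ⊥ (by simp) c d fun j _ => by rw [h j]; simp
  refine Finset.sum_eq_zero fun i hi => ?_
  rw [(Submodule.mem_bot ℂ).1 (hc i (Finset.mem_range.1 hi))]
  ext f : 1
  simp

/-- Differential operators that agree on all powers of `z` are equal. -/
theorem diffOps_ext {L L' : Module.End ℂ (smoothFun M)} (hL : L ∈ diffOps M)
    (hL' : L' ∈ diffOps M) (h : ∀ j : ℕ, L (z M ^ j) = L' (z M ^ j)) : L = L' :=
  sub_eq_zero.1 <| eq_zero_of_apply_z_pow (sub_mem_diffOps hL hL') fun j => by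
    rw [LinearMap.sub_apply, h, sub_self]

/-- Division with remainder by `∂^r`. -/
theorem OrderLT.exists_eq_mul_D_pow_add {r e : ℕ} {L : Module.End ℂ (smoothFun M)}
    (hL : OrderLT M (r + e) L) :
    ∃ S R, L = S * D M ^ r + R ∧ OrderLT M e S ∧ OrderLT M r R := by
  obtain ⟨c, rfl⟩ := hL
  refine ⟨∑ i ∈ Finset.range e, mulOp M (c (r + i)) * D M ^ i,
    ∑ i ∈ Finset.range r, mulOp M (c i) * D M ^ i, ?_, ⟨_, rfl⟩, ⟨_, rfl⟩⟩
  rw [Finset.sum_range_add, add_comm, Finset.sum_mul]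
  congr 1
  refine Finset.sum_congr rfl fun i _ => ?_
  rw [mul_assoc, ← pow_add, add_comm i r]

theorem D_pow_apply_polySpace {n r : ℕ} (h : n < r) {f : smoothFun M} (hf : f ∈ polySpace M n) :
    (D M ^ r) f = 0 := by
  obtain ⟨P, hP, rfl⟩ := (mem_polySpace M).1 hf
  rw [D_pow_aeval, iterate_derivative_eq_zero (by lia), map_zero]

end Functions

section Functions

variable {𝕜 : Type*} [RCLike 𝕜] [NormedAlgebra 𝕜 ℂ] (M : TopologicalSpace.Opens 𝕜)

/-! ### Noncommutative polynomials of bounded degree -/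

theorem ncPoly_mono {d e : ℕ} (h : d ≤ e) : ncPoly d ≤ ncPoly e :=
  Submodule.span_mono fun _ ⟨l, hl, hw⟩ => ⟨l, hl.trans h, hw⟩

theorem one_mem_ncPoly (d : ℕ) : 1 ∈ ncPoly d :=
  Submodule.subset_span ⟨[], by simp, by simp⟩

theorem ι_mem_ncPoly (i : Fin 3) : FreeAlgebra.ι ℂ i ∈ ncPoly 1 :=
  Submodule.subset_span ⟨[i], by simp, by simp⟩

theorem mul_mem_ncPoly {d e : ℕ} {p q : FreeAlgebra ℂ (Fin 3)} (hp : p ∈ ncPoly d)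
    (hq : q ∈ ncPoly e) : p * q ∈ ncPoly (d + e) := by
  have h := Submodule.mul_mem_mul hp hq
  rw [ncPoly, ncPoly, Submodule.span_mul_span] at h
  refine Submodule.span_mono ?_ h
  rintro _ ⟨_, ⟨l, hl, rfl⟩, _, ⟨l', hl', rfl⟩, rfl⟩
  exact ⟨l ++ l', by rw [List.length_append]; lia, by simp⟩

theorem pow_mem_ncPoly {p : FreeAlgebra ℂ (Fin 3)} (hp : p ∈ ncPoly 1) (e : ℕ) :
    p ^ e ∈ ncPoly e := by
  induction e with
  | zero => simpa using one_mem_ncPoly 0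
  | succ e ih => rw [pow_succ]; exact mul_mem_ncPoly ih hp

theorem aeval_mem_ncPoly {p : FreeAlgebra ℂ (Fin 3)} (hp : p ∈ ncPoly 1) {g : ℂ[X]} {r : ℕ}
    (hg : g.natDegree ≤ r) : aeval p g ∈ ncPoly r := by
  rw [aeval_eq_sum_range]
  refine Submodule.sum_mem _ fun i hi => Submodule.smul_mem _ _ ?_
  exact ncPoly_mono (by have := Finset.mem_range.1 hi; lia) (pow_mem_ncPoly hp i)

/-- The value of a noncommutative polynomial at the scalar operators `J_n^+, J_n^0, J_n^-`. -/
noncomputable def evalJ (n : ℕ) : FreeAlgebra ℂ (Fin 3) →ₐ[ℂ] Module.End ℂ (smoothFun M) :=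
  FreeAlgebra.lift ℂ ![Jplus M n, Jzero M n, Jminus M]

theorem evalJ_ι_zero (n : ℕ) : evalJ M n (FreeAlgebra.ι ℂ 0) = Jplus M n := by simp [evalJ]

theorem evalJ_ι_one (n : ℕ) : evalJ M n (FreeAlgebra.ι ℂ 1) = Jzero M n := by simp [evalJ]

theorem evalJ_ι_two (n : ℕ) : evalJ M n (FreeAlgebra.ι ℂ 2) = D M := by simp [evalJ, Jminus]

theorem Jplus_mem_diffOps (n : ℕ) : Jplus M n ∈ diffOps M :=
  sub_mem_diffOps (mul_mem (mulOp_mem_diffOps _) D_mem_diffOps)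
    (Subalgebra.smul_mem _ (mulOp_mem_diffOps _) _)

theorem euler_add_mem_diffOps (c : ℂ) : mulOp M (z M) * D M + c • 1 ∈ diffOps M :=
  add_mem (mul_mem (mulOp_mem_diffOps _) D_mem_diffOps)
    (Subalgebra.smul_mem _ (one_mem _) _)

theorem Jzero_eq (n : ℕ) : Jzero M n = mulOp M (z M) * D M + (-((n : ℂ) / 2)) • 1 := by
  ext f : 1
  simp [Jzero, sub_eq_add_neg]

theorem evalJ_mem_diffOps (n : ℕ) (p : FreeAlgebra ℂ (Fin 3)) : evalJ M n p ∈ diffOps M := by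
  induction p using FreeAlgebra.induction with
  | grade0 c => rw [AlgHom.commutes]; exact (diffOps M).algebraMap_mem c
  | grade1 i =>
    fin_cases i
    · exact (evalJ_ι_zero M n).symm ▸ Jplus_mem_diffOps M n
    · exact (evalJ_ι_one M n).symm ▸ Jzero_eq M n ▸ euler_add_mem_diffOps M _
    · exact (evalJ_ι_two M n).symm ▸ D_mem_diffOps
  | mul p q hp hq => rw [map_mul]; exact mul_mem hp hq
  | add p q hp hq => rw [map_add]; exact add_mem hp hq

theorem qbar_mem_diffOps (n Δ α : ℕ) : qbar M n Δ α ∈ diffOps M := by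
  refine mul_mem (list_prod_mem fun x hx => ?_) (pow_mem D_mem_diffOps _)
  obtain ⟨i, -, rfl⟩ := List.mem_map.1 hx
  exact euler_add_mem_diffOps M _

/-! ### Homogeneous operators -/

/-- `E` is homogeneous of degree `d` with symbol `f`: `E z^j = f(j) z^{j+d}` for all `j`, where
`f(j) = 0` whenever the exponent `j + d` is negative. -/
def IsShift (E : Module.End ℂ (smoothFun M)) (d : ℤ) (f : ℂ[X]) : Prop :=
  ∀ j : ℕ, E (z M ^ j) = f.eval (j : ℂ) • z M ^ ((j : ℤ) + d).toNat ∧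
    ((j : ℤ) + d < 0 → f.eval (j : ℂ) = 0)

variable {M}

theorem IsShift.congr {E : Module.End ℂ (smoothFun M)} {d d' : ℤ} {f f' : ℂ[X]}
    (h : IsShift M E d f) (hd : d = d') (hf : f = f') : IsShift M E d' f' := hd ▸ hf ▸ h

theorem IsShift.mul {E E' : Module.End ℂ (smoothFun M)} {d d' : ℤ} {f f' : ℂ[X]}
    (h' : IsShift M E' d' f') (h : IsShift M E d f) :
    IsShift M (E' * E) (d + d') (f * f'.comp (X + C (d : ℂ))) := by
  intro j
  obtain ⟨h1, h2⟩ := h j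
  rw [Module.End.mul_apply, h1, map_smul]
  simp only [eval_mul, eval_comp, eval_add, eval_X, eval_C]
  by_cases hj : (j : ℤ) + d < 0
  · simp [h2 hj]
  · obtain ⟨i, hi⟩ := Int.eq_ofNat_of_zero_le (not_lt.1 hj)
    obtain ⟨h3, h4⟩ := h' i
    have hc : (j : ℂ) + d = i := by exact_mod_cast hi
    have he : (j : ℤ) + (d + d') = i + d' := by lia
    rw [hc, he, hi, Int.toNat_natCast, h3, smul_smul]
    exact ⟨rfl, fun h => by rw [h4 h, mul_zero]⟩

theorem isShift_one : IsShift M 1 0 1 := fun j => by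
  refine ⟨by simp, fun h => by lia⟩

theorem isShift_mulOp_z_pow (α : ℕ) : IsShift M (mulOp M (z M ^ α)) α 1 := fun j => by
  refine ⟨?_, fun h => by lia⟩
  rw [mulOp_apply, ← pow_add, eval_one, one_smul]
  congr 1
  lia

theorem D_z_pow (j : ℕ) : D M (z M ^ j) = (j : ℂ) • z M ^ (j - 1) := by
  simpa using D_pow_z_pow M 1 j

theorem isShift_D : IsShift M (D M) (-1) X := fun j => by
  rw [D_z_pow, eval_X]
  refine ⟨?_, fun h => ?_⟩
  · congr 2
    lia
  · have : j = 0 := by lia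
    simp [this]

theorem z_mul_D_z_pow (j : ℕ) : z M * D M (z M ^ j) = (j : ℂ) • z M ^ j := by
  rw [D_z_pow, mul_smul_comm]
  cases j with
  | zero => simp
  | succ j => rw [Nat.add_sub_cancel, ← pow_succ']

theorem isShift_euler_add (c : ℂ) :
    IsShift M (mulOp M (z M) * D M + c • 1) 0 (X + C c) := fun j => by
  refine ⟨?_, fun h => by lia⟩
  simp [z_mul_D_z_pow, add_smul]

theorem isShift_Jplus (n : ℕ) : IsShift M (Jplus M n) 1 (X - C (n : ℂ)) := fun j => by
  refine ⟨?_, fun h => by lia⟩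
  have h : ((j : ℤ) + 1).toNat = j + 1 := by lia
  simp only [Jplus, LinearMap.sub_apply, Module.End.mul_apply, LinearMap.smul_apply, mulOp_apply,
    pow_two, mul_assoc, z_mul_D_z_pow, mul_smul_comm, eval_sub, eval_X, eval_C, sub_smul, h]
  rw [← pow_succ']

theorem IsShift.aeval {E : Module.End ℂ (smoothFun M)} {f : ℂ[X]} (h : IsShift M E 0 f)
    (g : ℂ[X]) : IsShift M (Polynomial.aeval E g) 0 (g.comp f) := fun j => by
  refine ⟨?_, fun h => by lia⟩
  have hE : E (z M ^ j) = f.eval (j : ℂ) • z M ^ j := by simpa using (h j).1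
  simp only [add_zero, Int.toNat_natCast, eval_comp]
  induction g using Polynomial.induction_on' with
  | add p q hp hq => simp [hp, hq, add_smul]
  | monomial i a =>
    have hpow : (E ^ i) (z M ^ j) = (f.eval (j : ℂ)) ^ i • z M ^ j := by
      induction i with
      | zero => simp
      | succ i ih => rw [pow_succ, Module.End.mul_apply, hE, map_smul, ih, smul_smul, pow_succ']
    simp [aeval_monomial, Algebra.algebraMap_eq_smul_one, hpow, smul_smul]

/-! ### Symbols with prescribed consecutive zeros -/

/-- The monic polynomial with the simple roots `u, u + 1, …, u + e - 1`. -/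
noncomputable def rootsFrom (u : ℤ) (e : ℕ) : ℂ[X] :=
  ∏ i ∈ Finset.range e, (X - C ((u : ℂ) + i))

theorem natDegree_rootsFrom (u : ℤ) (e : ℕ) : (rootsFrom u e).natDegree = e := by
  rw [rootsFrom, natDegree_prod_of_monic _ _ fun i _ => monic_X_sub_C _]
  simp only [natDegree_X_sub_C, Finset.sum_const, Finset.card_range, smul_eq_mul, mul_one]

theorem rootsFrom_ne_zero (u : ℤ) (e : ℕ) : rootsFrom u e ≠ 0 :=
  (monic_prod_of_monic _ _ fun _ _ => monic_X_sub_C _).ne_zero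

theorem rootsFrom_zero (u : ℤ) : rootsFrom u 0 = 1 := by simp [rootsFrom]

theorem rootsFrom_succ (u : ℤ) (e : ℕ) :
    rootsFrom u (e + 1) = rootsFrom u e * (X - C ((u : ℂ) + e)) :=
  Finset.prod_range_succ _ _

theorem rootsFrom_add (u : ℤ) (e e' : ℕ) :
    rootsFrom u (e + e') = rootsFrom u e * rootsFrom (u + e) e' := by
  rw [rootsFrom, Finset.prod_range_add]
  simp [rootsFrom, add_assoc]

theorem rootsFrom_comp (u d : ℤ) (e : ℕ) :
    (rootsFrom u e).comp (X + C (d : ℂ)) = rootsFrom (u - d) e := by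
  rw [rootsFrom, prod_comp]
  refine Finset.prod_congr rfl fun i _ => ?_
  simp only [sub_comp, X_comp, C_comp, add_comp, Int.cast_sub, C_add, C_sub]
  ring

theorem rootsFrom_dvd {u : ℤ} {e : ℕ} {f : ℂ[X]}
    (h : ∀ i < e, f.eval ((u : ℂ) + i) = 0) : rootsFrom u e ∣ f := by
  refine Finset.prod_dvd_of_coprime ?_ fun i hi => ?_
  · refine Pairwise.set_pairwise (pairwise_coprime_X_sub_C fun i i' h => ?_) _
    exact_mod_cast add_left_cancel h
  · exact dvd_iff_isRoot.2 (h i (Finset.mem_range.1 hi))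

theorem isCoprime_rootsFrom {u v : ℤ} {e e' : ℕ} (h : u + e ≤ v) :
    IsCoprime (rootsFrom u e) (rootsFrom v e') := by
  refine IsCoprime.prod_left fun i hi => IsCoprime.prod_right fun i' _ => ?_
  refine isCoprime_X_sub_C_of_isUnit_sub (IsUnit.mk0 _ (sub_ne_zero.2 ?_))
  have := Finset.mem_range.1 hi
  exact_mod_cast (by lia : u + i ≠ v + i')

theorem isShift_D_pow (e : ℕ) : IsShift M (D M ^ e) (-e) (rootsFrom 0 e) := by
  induction e with
  | zero => rw [rootsFrom_zero]; exact isShift_one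
  | succ e ih =>
    rw [pow_succ']
    refine (isShift_D.mul ih).congr (by push_cast; ring) ?_
    rw [rootsFrom_succ]
    simp [sub_eq_add_neg]

theorem isShift_Jplus_pow (n e : ℕ) :
    IsShift M (Jplus M n ^ e) e (rootsFrom (n - e + 1) e) := by
  induction e with
  | zero => rw [rootsFrom_zero]; exact isShift_one
  | succ e ih =>
    rw [pow_succ']
    refine ((isShift_Jplus n).mul ih).congr (by push_cast; ring) ?_
    rw [add_comm e 1, rootsFrom_add, mul_comm]
    congr 1
    · simp only [rootsFrom, Finset.prod_range_one, sub_comp, X_comp, C_comp]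
      push_cast
      simp only [C_add, C_sub, map_natCast, map_one, map_zero]
      ring
    · congr 1
      push_cast
      ring

theorem isShift_qbar (m Δ α : ℕ) :
    IsShift M (qbar M (m + Δ) Δ α) (-α)
      (rootsFrom 0 α * rootsFrom (m + α + 1) (Δ - α)) := by
  have h : ∀ r : ℕ, IsShift M ((List.range r).map fun i : ℕ =>
      mulOp M (z M) * D M + (-((m + Δ : ℕ) : ℂ) + (Δ : ℂ) - ((i : ℂ) + 1)) • 1).prod 0
      (rootsFrom (m + 1) r) := by
    intro r
    induction r with
    | zero => rw [rootsFrom_zero]; exact isShift_one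
    | succ r ih =>
      rw [List.range_succ, List.map_append, List.prod_append]
      simp only [List.map_cons, List.map_nil, List.prod_cons, List.prod_nil, mul_one]
      refine (ih.mul (isShift_euler_add _)).congr (by ring) ?_
      rw [rootsFrom_comp, rootsFrom_succ, sub_zero, mul_comm]
      congr 1
      push_cast
      simp only [C_add, C_sub, C_neg, map_natCast, map_one]
      ring
  refine ((h (Δ - α)).mul (isShift_D_pow α)).congr (by ring) ?_
  rw [rootsFrom_comp]
  congr 2
  ring

/-- A symbol divisible by the symbol `π` of `B` is realised by `B` followed on the right by a
polynomial in `J_n^0`, since the latter acts on `z^j` by an arbitrary polynomial in `j`. -/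
theorem IsShift.exists_mul_evalJ {B : Module.End ℂ (smoothFun M)} {d : ℤ} {π f : ℂ[X]}
    (hB : IsShift M B d π) (hπ : π ∣ f) (hf : f ≠ 0) {k : ℕ} (hk : f.natDegree ≤ k) (n : ℕ) :
    π.natDegree ≤ k ∧ ∃ p ∈ ncPoly (k - π.natDegree), IsShift M (B * evalJ M n p) d f := by
  obtain ⟨g, rfl⟩ := hπ
  rw [natDegree_mul (left_ne_zero_of_mul hf) (right_ne_zero_of_mul hf)] at hk
  refine ⟨by lia, Polynomial.aeval (FreeAlgebra.ι ℂ 1 + ((n : ℂ) / 2) • 1) g,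
    aeval_mem_ncPoly (add_mem (ι_mem_ncPoly 1) (Submodule.smul_mem _ _ (one_mem_ncPoly 1)))
      (by lia), ?_⟩
  rw [← Polynomial.aeval_algHom_apply, map_add, map_smul, map_one, evalJ_ι_one]
  have h0 : IsShift M (Jzero M n + ((n : ℂ) / 2) • 1) 0 X := by
    have h : Jzero M n + ((n : ℂ) / 2) • 1 = mulOp M (z M) * D M + (0 : ℂ) • 1 := by
      ext f : 1
      simp [Jzero]
    exact h ▸ (isShift_euler_add 0).congr rfl (by simp)
  refine (hB.mul (h0.aeval g)).congr (by ring) ?_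
  simp [mul_comm]

end Functions

section Functions

variable {𝕜 : Type*} [RCLike 𝕜] [NormedAlgebra 𝕜 ℂ] {M : TopologicalSpace.Opens 𝕜}

/-! ### Operators between spaces of polynomials -/

/-- An operator of order at most `k ≤ a` that maps `P_a` into polynomials acts on all powers of `z`
by `z^j ↦ ∑_d f_d(j) z^{j+d}`, with symbols `f_d` that are polynomials of degree at most `k`. -/
theorem exists_symbols {a b k : ℕ} (hk : k ≤ a) {L : Module.End ℂ (smoothFun M)}
    (hL : OrderLE M k L) (hP : ∀ f ∈ polySpace M a, L f ∈ polySpace M b) :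
    ∃ (P : ℕ → ℂ[X]) (f : ℤ → ℂ[X]), (∀ j, L (z M ^ j) = aeval (z M) (P j)) ∧
      (∀ d, (f d).natDegree ≤ k) ∧ (∀ d : ℤ, d < -k → f d = 0) ∧
      (∀ (j : ℕ) (d : ℤ), (j : ℤ) + d < 0 → (f d).eval (j : ℂ) = 0) ∧
      ∀ (j l : ℕ), (P j).coeff l = (f (l - j)).eval (j : ℂ) := by
  obtain ⟨c, rfl⟩ := hL
  have hc := coeff_mem_of_apply_z_pow_mem
    (Subalgebra.toSubmodule (aeval (z M) : ℂ[X] →ₐ[ℂ] smoothFun M).range)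
    (fun f hf => (aeval (z M) : ℂ[X] →ₐ[ℂ] smoothFun M).range.mul_mem hf ⟨X, by simp⟩) c (k + 1)
    fun j hj => by
      obtain ⟨P, -, hP⟩ := (mem_polySpace M).1 (hP _ (z_pow_mem_polySpace M (by lia : j ≤ a)))
      exact ⟨P, hP⟩
  have hc' : ∀ j, ∃ P : ℂ[X], j < k + 1 → aeval (z M) P = c j := fun j => by
    by_cases hj : j < k + 1
    · obtain ⟨P, hP⟩ := hc j hj
      exact ⟨P, fun _ => hP⟩
    · exact ⟨0, fun h => absurd h hj⟩
  choose p hp using hc'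
  refine ⟨fun j => ∑ i ∈ Finset.range (k + 1),
      (j.descFactorial i : ℂ) • (p i * X ^ (j - i)),
    fun d => ∑ i ∈ Finset.range (k + 1),
      C (if 0 ≤ (i : ℤ) + d then (p i).coeff ((i : ℤ) + d).toNat else 0) * descPochhammer ℂ i,
    fun j => ?_, fun d => ?_, fun d hd => ?_, fun j d hjd => ?_, fun j l => ?_⟩
  · rw [sum_mulOp_apply_z_pow, map_sum]
    refine Finset.sum_congr rfl fun i hi => ?_
    rw [map_smul, map_mul, hp i (Finset.mem_range.1 hi), map_pow, aeval_X]
  · refine natDegree_sum_le_of_forall_le _ _ fun i hi => (natDegree_C_mul_le _ _).trans ?_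
    rw [descPochhammer_natDegree]
    have := Finset.mem_range.1 hi
    lia
  · refine Finset.sum_eq_zero fun i hi => ?_
    have := Finset.mem_range.1 hi
    rw [if_neg (by lia), C_0, zero_mul]
  · rw [eval_finsetSum]
    refine Finset.sum_eq_zero fun i _ => ?_
    rw [eval_mul, eval_C, descPochhammer_eval_eq_descFactorial]
    by_cases hij : i ≤ j
    · rw [if_neg (by lia), zero_mul]
    · rw [Nat.descFactorial_of_lt (by lia), Nat.cast_zero, mul_zero]
  · rw [finsetSum_coeff, eval_finsetSum]
    refine Finset.sum_congr rfl fun i _ => ?_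
    rw [eval_mul, eval_C, descPochhammer_eval_eq_descFactorial, coeff_smul, coeff_mul_X_pow',
      smul_eq_mul, mul_comm]
    by_cases hij : i ≤ j
    · congr 1
      refine ite_congr (propext (by lia)) (fun _ => ?_) fun _ => rfl
      congr 1
      lia
    · rw [Nat.descFactorial_of_lt (by lia), Nat.cast_zero, mul_zero, mul_zero]

theorem eq_zero_of_eval_natCast_eq_zero {f : ℂ[X]} {a : ℕ} (hf : f.natDegree ≤ a)
    (h : ∀ j : ℕ, j ≤ a → f.eval (j : ℂ) = 0) : f = 0 := by
  by_contra hne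
  have hdvd : rootsFrom 0 (a + 1) ∣ f := rootsFrom_dvd fun i hi => by
    simpa using h i (by lia)
  have := natDegree_le_of_dvd hdvd hne
  rw [natDegree_rootsFrom] at this
  lia

/-- To show that an operator `P_a → P_b` of order at most `k ≤ a` lies in a space `V` of
differential operators, it suffices to realise in `V` every homogeneous symbol of degree at most `k`
that vanishes where `P_a → P_b` forces it to. -/
theorem mem_of_exists_isShift (hM : (M : Set 𝕜).Nonempty) {a b k : ℕ} (hk : k ≤ a)
    {L : Module.End ℂ (smoothFun M)} (hL : OrderLE M k L)
    (hP : ∀ f ∈ polySpace M a, L f ∈ polySpace M b)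
    (V : Submodule ℂ (Module.End ℂ (smoothFun M)))
    (hV : V ≤ Subalgebra.toSubmodule (diffOps M))
    (h : ∀ (d : ℤ) (f : ℂ[X]), -a ≤ d → d ≤ b → f.natDegree ≤ k → f ≠ 0 →
      (∀ j : ℕ, j ≤ a → (j : ℤ) + d < 0 ∨ (b : ℤ) < j + d → f.eval (j : ℂ) = 0) →
      ∃ E ∈ V, IsShift M E d f) : L ∈ V := by
  obtain ⟨P, f, hLP, hdeg, hlow, hneg, hcoeff⟩ := exists_symbols hk hL hP
  have hvan : ∀ (d : ℤ) (j : ℕ), j ≤ a → (j : ℤ) + d < 0 ∨ (b : ℤ) < j + d →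
      (f d).eval (j : ℂ) = 0 := by
    rintro d j hj (hd | hd)
    · exact hneg j d hd
    · obtain ⟨R, hR, hRe⟩ := (mem_polySpace M).1 (hP _ (z_pow_mem_polySpace M hj))
      rw [hLP] at hRe
      have hRP := aeval_z_injective M hM hRe
      have h1 := hcoeff j ((j : ℤ) + d).toNat
      rw [← hRP, coeff_eq_zero_of_natDegree_lt (by lia)] at h1
      rw [h1]
      congr 2
      lia
  have hhigh : ∀ d : ℤ, (b : ℤ) < d → f d = 0 := fun d hd =>
    eq_zero_of_eval_natCast_eq_zero ((hdeg d).trans hk) fun j hj => hvan d j hj (by lia)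
  have hE : ∀ d : ℤ, ∃ E ∈ V, IsShift M E d (f d) := by
    intro d
    by_cases hfd : f d = 0
    · exact ⟨0, V.zero_mem, fun j => by simp [hfd]⟩
    · refine h d (f d) ?_ ?_ (hdeg d) hfd (hvan d)
      · by_contra hd
        exact hfd (hlow d (by lia))
      · by_contra hd
        exact hfd (hhigh d (by lia))
  choose E hEV hEs using hE
  have hsum : L = ∑ d ∈ Finset.Icc (-(k : ℤ)) b, E d := by
    refine diffOps_ext ⟨_, hL⟩ (sum_mem fun d _ => hV (hEV d)) fun j => ?_
    have hPj : P j = ∑ d ∈ Finset.Icc (-(k : ℤ)) b,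
        (f d).eval (j : ℂ) • X ^ ((j : ℤ) + d).toNat := by
      ext l
      rw [finsetSum_coeff, hcoeff, Finset.sum_eq_single ((l : ℤ) - j)]
      · simp
      · intro d _ hd
        rw [coeff_smul, coeff_X_pow]
        by_cases hjd : (j : ℤ) + d < 0
        · rw [hneg j d hjd, zero_smul]
        · rw [if_neg (by lia), smul_zero]
      · intro hd
        have h0 : f ((l : ℤ) - j) = 0 := by
          rw [Finset.mem_Icc, not_and_or, not_le, not_le] at hd
          exact hd.elim (hlow _) (hhigh _)
        simp [h0]
    rw [hLP, hPj, map_sum, LinearMap.sum_apply]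
    refine Finset.sum_congr rfl fun d _ => ?_
    rw [(hEs d j).1, map_smul, map_pow, aeval_X]
  rw [hsum]
  exact sum_mem fun d _ => hEV d

/-- Elements of the span of the products `B_α p(J_n)` in normal form. -/
theorem exists_eq_sum_mul_evalJ {B : ℕ → Module.End ℂ (smoothFun M)} {s : Finset ℕ}
    {N : Submodule ℂ (FreeAlgebra ℂ (Fin 3))} {n : ℕ} {L : Module.End ℂ (smoothFun M)}
    (hL : L ∈ Submodule.span ℂ {E | ∃ α ∈ s, ∃ p ∈ N, E = B α * evalJ M n p}) :
    ∃ r : ℕ → FreeAlgebra ℂ (Fin 3), (∀ α, r α ∈ N) ∧ L = ∑ α ∈ s, B α * evalJ M n (r α) := by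
  induction hL using Submodule.span_induction with
  | mem x hx =>
    obtain ⟨α, hα, p, hp, rfl⟩ := hx
    refine ⟨Pi.single α p, fun β => ?_, ?_⟩
    · by_cases h : β = α
      · subst h; simpa using hp
      · rw [Pi.single_eq_of_ne h]; exact N.zero_mem
    · rw [Finset.sum_eq_single α]
      · rw [Pi.single_eq_same]
      · intro β _ h
        rw [Pi.single_eq_of_ne h, map_zero, mul_zero]
      · exact fun h => absurd hα h
  | zero => exact ⟨0, fun _ => N.zero_mem, by simp⟩
  | add x y _ _ hx hy =>
    obtain ⟨r, hr, rfl⟩ := hx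
    obtain ⟨r', hr', rfl⟩ := hy
    exact ⟨r + r', fun α => N.add_mem (hr α) (hr' α), by
      simp [mul_add, Finset.sum_add_distrib]⟩
  | smul c x _ hx =>
    obtain ⟨r, hr, rfl⟩ := hx
    exact ⟨c • r, fun α => N.smul_mem c (hr α), by simp [Finset.smul_sum]⟩

/-- Operators `P_m → P_{m+Δ}` of order at most `k ≤ m`. The symbol of degree `d` is realised by
`∂^{-d}` if `d < 0` and by `z^α (J_m^+)^{d-α}` with `α = min d Δ` otherwise. -/
theorem exists_eq_sum_mulOp_mul_evalJ (hM : (M : Set 𝕜).Nonempty) {m Δ k : ℕ} (hk : k ≤ m)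
    {L : Module.End ℂ (smoothFun M)} (hL : OrderLE M k L)
    (hP : ∀ f ∈ polySpace M m, L f ∈ polySpace M (m + Δ)) :
    ∃ q : ℕ → FreeAlgebra ℂ (Fin 3), (∀ α, q α ∈ ncPoly k) ∧
      L = ∑ α ∈ Finset.range (Δ + 1), mulOp M (z M ^ α) * evalJ M m (q α) := by
  refine exists_eq_sum_mul_evalJ (B := fun α => mulOp M (z M ^ α))
    (mem_of_exists_isShift hM hk hL hP _ (Submodule.span_le.2 ?_) fun d f hd hd' hf hf0 hv => ?_)
  · rintro _ ⟨α, -, p, -, rfl⟩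
    exact (diffOps M).mul_mem (mulOp_mem_diffOps (z M ^ α)) (evalJ_mem_diffOps M m p)
  rcases lt_or_ge d 0 with h | h
  · obtain ⟨e, rfl⟩ : ∃ e : ℕ, d = -e := ⟨d.natAbs, by lia⟩
    obtain ⟨h1, p, hp, hs⟩ := (isShift_D_pow (M := M) e).exists_mul_evalJ
      (rootsFrom_dvd fun i hi => by simpa using hv i (by lia) (by lia)) hf0 hf m
    rw [natDegree_rootsFrom] at h1 hp
    refine ⟨_, Submodule.subset_span ⟨0, by simp, FreeAlgebra.ι ℂ 2 ^ e * p, ?_, rfl⟩, ?_⟩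
    · exact ncPoly_mono (by lia) (mul_mem_ncPoly (pow_mem_ncPoly (ι_mem_ncPoly 2) e) hp)
    · have h2 : mulOp M (z M ^ 0) = 1 := by ext g : 1; simp
      rwa [h2, one_mul, map_mul, map_pow, evalJ_ι_two]
  · obtain ⟨α, e, rfl, hα, hαe⟩ : ∃ α e : ℕ, d = (e : ℤ) + α ∧ α ≤ Δ ∧ (e ≠ 0 → α = Δ) :=
      ⟨min d.toNat Δ, d.toNat - Δ, by lia, by lia, by lia⟩
    have hB : IsShift M (mulOp M (z M ^ α) * Jplus M m ^ e) (e + α)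
        (rootsFrom (m - e + 1) e) :=
      ((isShift_mulOp_z_pow α).mul (isShift_Jplus_pow m e)).congr rfl (by simp)
    obtain ⟨h1, p, hp, hs⟩ := hB.exists_mul_evalJ (rootsFrom_dvd fun i hi => by
      obtain ⟨j, hj⟩ : ∃ j : ℕ, (j : ℤ) = m - e + 1 + i :=
        ⟨((m : ℤ) - e + 1 + i).toNat, by lia⟩
      have := hv j (by lia) (by lia)
      rwa [show (j : ℂ) = ((m - e + 1 : ℤ) : ℂ) + i by exact_mod_cast hj] at this) hf0 hf m
    rw [natDegree_rootsFrom] at h1 hp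
    refine ⟨_, Submodule.subset_span ⟨α, by simp; lia, FreeAlgebra.ι ℂ 0 ^ e * p, ?_, rfl⟩, ?_⟩
    · exact ncPoly_mono (by lia) (mul_mem_ncPoly (pow_mem_ncPoly (ι_mem_ncPoly 0) e) hp)
    · rwa [map_mul, map_pow, evalJ_ι_zero, ← mul_assoc]

/-- Operators `P_{m+Δ} → P_m` of order at most `k ≤ m + Δ`. At most `m + 1` of the exponents
`0, …, m + Δ` are moved into `[0, m]` by a shift of degree `d`, so every symbol has at least `Δ`
zeros. The symbol of degree `d` is realised by `q_0 (J^+)^d` if `d > 0`, by `q_{-d}` if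
`-Δ ≤ d ≤ 0`, and by `q_Δ ∂^{-d-Δ}` if `d < -Δ`. -/
theorem exists_eq_sum_qbar_mul_evalJ (hM : (M : Set 𝕜).Nonempty) {m Δ k : ℕ} (hk : k ≤ m + Δ)
    {L : Module.End ℂ (smoothFun M)} (hL : OrderLE M k L)
    (hP : ∀ f ∈ polySpace M (m + Δ), L f ∈ polySpace M m) :
    (∃ r : ℕ → FreeAlgebra ℂ (Fin 3), (∀ α, r α ∈ ncPoly (k - Δ)) ∧
      L = ∑ α ∈ Finset.range (Δ + 1), qbar M (m + Δ) Δ α * evalJ M (m + Δ) (r α)) ∧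
    (k < Δ → L = 0) := by
  -- For `k < Δ` the truncated difference `k - Δ` is `0`; the zero space of polynomials is used
  -- there instead, so that one argument yields both claims.
  have key := mem_of_exists_isShift hM hk hL hP
    (Submodule.span ℂ {E | ∃ α ∈ Finset.range (Δ + 1), ∃ p ∈ (if k < Δ then ⊥ else ncPoly (k - Δ)),
      E = qbar M (m + Δ) Δ α * evalJ M (m + Δ) p}) (Submodule.span_le.2 ?_)
    fun d f hd hd' hf hf0 hv => ?_
  · obtain ⟨r, hr, rfl⟩ := exists_eq_sum_mul_evalJ key
    refine ⟨⟨r, fun α => ?_, rfl⟩, fun h => Finset.sum_eq_zero fun α _ => ?_⟩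
    · have := hr α
      split_ifs at this
      · rw [(Submodule.mem_bot ℂ).1 this]; exact zero_mem _
      · exact this
    · have := hr α
      rw [if_pos h, Submodule.mem_bot] at this
      rw [this, map_zero, mul_zero]
  · rintro _ ⟨α, -, p, -, rfl⟩
    exact (diffOps M).mul_mem (qbar_mem_diffOps M _ _ _) (evalJ_mem_diffOps M _ p)
  have hroot : ∀ (u : ℤ) (e : ℕ), (∀ i : ℕ, i < e → 0 ≤ u + i ∧ u + i ≤ m + Δ ∧
      (u + i + d < 0 ∨ (m : ℤ) < u + i + d)) → rootsFrom u e ∣ f := by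
    refine fun u e h => rootsFrom_dvd fun i hi => ?_
    obtain ⟨h1, h2, h3⟩ := h i hi
    obtain ⟨j, hj⟩ := Int.eq_ofNat_of_zero_le h1
    rw [show (u : ℂ) + i = j by exact_mod_cast hj]
    exact hv j (by lia) (by lia)
  rcases lt_or_ge 0 d with h | h
  · obtain ⟨e, rfl⟩ := Int.eq_ofNat_of_zero_le h.le
    have hB : IsShift M (qbar M (m + Δ) Δ 0 * Jplus M (m + Δ) ^ e) e
        (rootsFrom (m - e + 1) (Δ + e)) := by
      refine ((isShift_qbar m Δ 0).mul (isShift_Jplus_pow (m + Δ) e)).congr (by simp) ?_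
      rw [rootsFrom_zero, one_mul, rootsFrom_comp, rootsFrom_add, mul_comm]
      congr 2 <;> push_cast <;> ring
    obtain ⟨h1, p, hp, hs⟩ := hB.exists_mul_evalJ (hroot _ _ fun i hi => by lia) hf0 hf (m + Δ)
    rw [natDegree_rootsFrom] at h1 hp
    refine ⟨_, Submodule.subset_span ⟨0, by simp, FreeAlgebra.ι ℂ 0 ^ e * p, ?_, rfl⟩, ?_⟩
    · rw [if_neg (by lia)]
      exact ncPoly_mono (by lia) (mul_mem_ncPoly (pow_mem_ncPoly (ι_mem_ncPoly 0) e) hp)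
    · rwa [map_mul, map_pow, evalJ_ι_zero, ← mul_assoc]
  · obtain ⟨α, e, rfl, hα, hαe⟩ :
        ∃ α e : ℕ, d = -(e : ℤ) - α ∧ α ≤ Δ ∧ (e ≠ 0 → α = Δ) :=
      ⟨min (-d).toNat Δ, (-d).toNat - Δ, by lia, by lia, by lia⟩
    have hB : IsShift M (qbar M (m + Δ) Δ α * D M ^ e) (-e - α)
        (rootsFrom 0 (e + α) * rootsFrom (m + α + e + 1) (Δ - α)) := by
      refine ((isShift_qbar m Δ α).mul (isShift_D_pow e)).congr (by ring) ?_
      rw [mul_comp, rootsFrom_comp, rootsFrom_comp, rootsFrom_add, mul_assoc]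
      congr 3 <;> ring_nf
    obtain ⟨h1, p, hp, hs⟩ := hB.exists_mul_evalJ ((isCoprime_rootsFrom (by lia)).mul_dvd
      (hroot _ _ fun i hi => by lia) (hroot _ _ fun i hi => by lia)) hf0 hf (m + Δ)
    rw [natDegree_mul (rootsFrom_ne_zero _ _) (rootsFrom_ne_zero _ _), natDegree_rootsFrom,
      natDegree_rootsFrom] at h1 hp
    refine ⟨_, Submodule.subset_span ⟨α, by simp; lia, FreeAlgebra.ι ℂ 2 ^ e * p, ?_, rfl⟩, ?_⟩
    · rw [if_neg (by lia)]
      exact ncPoly_mono (by lia) (mul_mem_ncPoly (pow_mem_ncPoly (ι_mem_ncPoly 2) e) hp)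
    · rwa [map_mul, map_pow, evalJ_ι_two, ← mul_assoc]

end Functions

section Functions

variable {𝕜 : Type*} [RCLike 𝕜] [NormedAlgebra 𝕜 ℂ] {M : TopologicalSpace.Opens 𝕜}

/-! ### Matrix operators -/

theorem evalT_eq (m n : ℕ) (p : FreeAlgebra ℂ (Fin 3)) :
    evalT M m n p = !![evalJ M m p, 0; 0, evalJ M n p] := by
  induction p using FreeAlgebra.induction with
  | grade0 c =>
    rw [evalT, AlgHom.commutes, AlgHom.commutes, AlgHom.commutes]
    ext i j : 2
    fin_cases i <;> fin_cases j <;> simp [Matrix.algebraMap_matrix_apply]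
  | grade1 i =>
    rw [evalT, FreeAlgebra.lift_ι_apply]
    fin_cases i <;> simp [Tgen, evalJ]
  | mul p q hp hq =>
    simp only [evalT] at hp hq ⊢
    rw [map_mul, hp, hq]
    simp
  | add p q hp hq =>
    simp only [evalT] at hp hq ⊢
    rw [map_add, hp, hq]
    simp

/-- `J` and its replacement `J̃` are diagonal with two different scalar entries. -/
theorem exists_Jform_eq (m n : ℕ) (hmn : m ≤ n) :
    ∃ c d : ℂ, c ≠ d ∧ Jform M m n = !![c • 1, 0; 0, d • 1] := by
  rw [Jform]
  split_ifs with h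
  · refine ⟨1, -1, by norm_num, ?_⟩
    ext i j f : 3
    fin_cases i <;> fin_cases j <;> simp [sigma3]
  · refine ⟨_, _, ?_, rfl⟩
    have h1 : ((n - m : ℕ) : ℂ) ≠ 0 := by exact_mod_cast (by lia : n - m ≠ 0)
    intro h2
    apply h1
    linear_combination 2 * h2

theorem mem_polyVecSpace {m n : ℕ} {ψ : Fin 2 → smoothFun M} :
    ψ ∈ polyVecSpace M m n ↔ ψ 0 ∈ polySpace M m ∧ ψ 1 ∈ polySpace M n := by
  simp [polyVecSpace, Submodule.mem_pi, Fin.forall_fin_two]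

theorem preserves_iff {m n : ℕ} {T : MatOp M} : Preserves M m n T ↔
    (∀ f ∈ polySpace M m, T 0 0 f ∈ polySpace M m ∧ T 1 0 f ∈ polySpace M n) ∧
    ∀ f ∈ polySpace M n, T 0 1 f ∈ polySpace M m ∧ T 1 1 f ∈ polySpace M n := by
  simp only [Preserves, mem_polyVecSpace, MatOp.act, Fin.sum_univ_two]
  refine ⟨fun h => ⟨fun f hf => ?_, fun f hf => ?_⟩, fun h ψ hψ => ?_⟩
  · simpa using h ![f, 0] (by simpa using hf)
  · simpa using h ![0, f] (by simpa using hf)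
  · obtain ⟨h0, h1⟩ := h.1 _ hψ.1
    obtain ⟨h2, h3⟩ := h.2 _ hψ.2
    exact ⟨add_mem h0 h2, add_mem h1 h3⟩

theorem lowerForm_eq {m n : ℕ} {c d : ℂ} (hJ : Jform M m n = !![c • 1, 0; 0, d • 1])
    (p p₁ : FreeAlgebra ℂ (Fin 3)) (q : ℕ → FreeAlgebra ℂ (Fin 3)) :
    lowerForm M m n p p₁ q = !![evalJ M m (p + c • p₁), 0;
      ∑ α ∈ Finset.range (n - m + 1), mulOp M (z M ^ α) * evalJ M m (q α),
      evalJ M n (p + d • p₁)] := by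
  have hQ : ∀ α, Q M α * evalT M m n (q α) = !![0, 0; mulOp M (z M ^ α) * evalJ M m (q α), 0] := by
    intro α
    ext i j : 2
    fin_cases i <;> fin_cases j <;> simp [evalT_eq, Q]
  simp only [lowerForm, hQ]
  rw [hJ, evalT_eq, evalT_eq]
  ext i j : 2
  fin_cases i <;> fin_cases j <;> simp [Matrix.sum_apply]

theorem upperForm_eq (m n : ℕ) (r : ℕ → FreeAlgebra ℂ (Fin 3)) :
    upperForm M m n r = !![0,
      ∑ α ∈ Finset.range (n - m + 1), qbar M n (n - m) α * evalJ M n (r α); 0, 0] := by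
  have hQ : ∀ α, Qbar M m n α * evalT M m n (r α)
      = !![0, qbar M n (n - m) α * evalJ M n (r α); 0, 0] := by
    intro α
    ext i j : 2
    fin_cases i <;> fin_cases j <;> simp [evalT_eq, Qbar]
  simp only [upperForm, hQ]
  ext i j : 2
  fin_cases i <;> fin_cases j <;> simp [Matrix.sum_apply]

theorem evalT_mem_adjoin (m n : ℕ) (p : FreeAlgebra ℂ (Fin 3)) :
    evalT M m n p ∈ Algebra.adjoin ℂ (generators M m n) := by
  induction p using FreeAlgebra.induction with
  | grade0 c => rw [evalT, AlgHom.commutes]; exact Subalgebra.algebraMap_mem _ c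
  | grade1 i =>
    rw [evalT, FreeAlgebra.lift_ι_apply]
    exact Algebra.subset_adjoin (Or.inl (Or.inl (Or.inl ⟨i, rfl⟩)))
  | mul p q hp hq => rw [evalT, map_mul]; exact mul_mem hp hq
  | add p q hp hq => rw [evalT, map_add]; exact add_mem hp hq

theorem Q_mem_adjoin {m n α : ℕ} (h : α ≤ n - m) :
    Q M α ∈ Algebra.adjoin ℂ (generators M m n) :=
  Algebra.subset_adjoin (Or.inl (Or.inr ⟨α, h, rfl⟩))

theorem Qbar_mem_adjoin {m n α : ℕ} (h : α ≤ n - m) :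
    Qbar M m n α ∈ Algebra.adjoin ℂ (generators M m n) :=
  Algebra.subset_adjoin (Or.inr ⟨α, h, rfl⟩)

theorem Jform_mem_adjoin (m n : ℕ) : Jform M m n ∈ Algebra.adjoin ℂ (generators M m n) := by
  rw [Jform]
  split_ifs with h
  · subst h
    -- For equal degrees `Q_0` and `Q̄_0` are the matrix units `σ^-` and `σ^+`.
    have h1 : sigma3 M = Qbar M n n 0 * Q M 0 + (-1 : ℂ) • (Q M 0 * Qbar M n n 0) := by
      ext i j f : 3
      fin_cases i <;> fin_cases j <;>
        simp [sigma3, Q, Qbar, qbar]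
    rw [h1]
    exact add_mem (mul_mem (Qbar_mem_adjoin (by lia)) (Q_mem_adjoin (by lia)))
      (Subalgebra.smul_mem _ (mul_mem (Q_mem_adjoin (by lia)) (Qbar_mem_adjoin (by lia))) _)
  · exact Algebra.subset_adjoin (Or.inl (Or.inl (Or.inr rfl)))

theorem lowerForm_mem_adjoin (m n : ℕ) (p p₁ : FreeAlgebra ℂ (Fin 3))
    (q : ℕ → FreeAlgebra ℂ (Fin 3)) :
    lowerForm M m n p p₁ q ∈ Algebra.adjoin ℂ (generators M m n) :=
  add_mem (add_mem (evalT_mem_adjoin _ _ _) (mul_mem (Jform_mem_adjoin _ _)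
    (evalT_mem_adjoin _ _ _))) (sum_mem fun α hα => mul_mem
      (Q_mem_adjoin (by have := Finset.mem_range.1 hα; lia)) (evalT_mem_adjoin _ _ _))

theorem upperForm_mem_adjoin (m n : ℕ) (r : ℕ → FreeAlgebra ℂ (Fin 3)) :
    upperForm M m n r ∈ Algebra.adjoin ℂ (generators M m n) :=
  sum_mem fun α hα => mul_mem
    (Qbar_mem_adjoin (by have := Finset.mem_range.1 hα; lia)) (evalT_mem_adjoin _ _ _)

/-- The normal form, for operators whose first column has order at most `m` as well as `k` and whose
second column has order at most `k ≤ n`. -/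
theorem satisfiesI_of_preserves (hM : (M : Set 𝕜).Nonempty) {m n k : ℕ} (hmn : m ≤ n)
    (hk : k ≤ n) {R : MatOp M} (h0 : ∀ i, OrderLE M (min m k) (R i 0))
    (h1 : ∀ i, OrderLE M k (R i 1)) (hR : Preserves M m n R) : SatisfiesI M m n k R := by
  rw [preserves_iff] at hR
  obtain ⟨hR0, hR1⟩ := hR
  obtain ⟨c, d, hcd, hJ⟩ := exists_Jform_eq (M := M) m n hmn
  obtain ⟨Δ, rfl⟩ := Nat.exists_eq_add_of_le hmn
  obtain ⟨a, ha, ha'⟩ := exists_eq_sum_mulOp_mul_evalJ (Δ := 0) hM (min_le_left m k) (h0 0)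
    fun f hf => (hR0 f hf).1
  obtain ⟨q, hq, hq'⟩ := exists_eq_sum_mulOp_mul_evalJ hM (min_le_left m k) (h0 1)
    fun f hf => (hR0 f hf).2
  obtain ⟨b, hb, hb'⟩ := exists_eq_sum_mulOp_mul_evalJ (Δ := 0) hM hk (h1 1)
    fun f hf => (hR1 f hf).2
  obtain ⟨⟨r, hr, hr'⟩, hzero⟩ := exists_eq_sum_qbar_mul_evalJ hM hk (h1 0)
    fun f hf => (hR1 f hf).1
  have hmon : ncPoly (min m k) ≤ ncPoly k := ncPoly_mono (min_le_right m k)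
  have hone : mulOp M (z M ^ 0) = 1 := by ext g : 1; simp
  simp only [zero_add, Finset.sum_range_one, hone, one_mul] at ha' hb'
  -- The diagonal entries `a(J_m)` and `b(J_n)` are interpolated by `p + J p₁`.
  set p₁ := (c - d)⁻¹ • (a 0 - b 0) with hp₁
  set p := a 0 - c • p₁ with hp
  have hpc : p + c • p₁ = a 0 := by rw [hp]; abel
  have hpd : p + d • p₁ = b 0 := by
    have : (c - d) • p₁ = a 0 - b 0 := smul_inv_smul₀ (sub_ne_zero.2 hcd) _
    rw [sub_smul] at this
    rw [hp, sub_add, this, sub_sub_cancel]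
  have hp₁mem : p₁ ∈ ncPoly k :=
    Submodule.smul_mem _ _ (Submodule.sub_mem _ (hmon (ha 0)) (hb 0))
  have hpmem : p ∈ ncPoly k :=
    Submodule.sub_mem _ (hmon (ha 0)) (Submodule.smul_mem _ _ hp₁mem)
  have hform : R = lowerForm M m (m + Δ) p p₁ q + upperForm M m (m + Δ) r := by
    rw [lowerForm_eq hJ, upperForm_eq, hpc, hpd]
    simp only [Nat.add_sub_cancel_left]
    rw [← hr', ← hq', ← ha', ← hb']
    ext i j : 2
    fin_cases i <;> fin_cases j <;> simp
  refine ⟨?_, fun _ => ?_, fun hkΔ => ⟨?_, ?_⟩⟩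
  · rw [hform]
    exact add_mem (lowerForm_mem_adjoin _ _ _ _ _) (upperForm_mem_adjoin _ _ _)
  · refine ⟨p, hpmem, p₁, hp₁mem, r, q, ?_, fun α => hmon (hq α), hform⟩
    rwa [Nat.add_sub_cancel_left]
  · refine ⟨p, hpmem, p₁, hp₁mem, q, fun α => hmon (hq α), ?_⟩
    rw [Nat.add_sub_cancel_left] at hkΔ
    rw [upperForm_eq] at hform
    simp only [Nat.add_sub_cancel_left] at hform
    rw [← hr', hzero hkΔ] at hform
    rw [hform]
    ext i j : 2
    fin_cases i <;> fin_cases j <;> simp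
  · intro p' p₁' r' q' h
    rw [Nat.add_sub_cancel_left] at hkΔ
    have h01 : R 0 1 = upperForm M m (m + Δ) r' 0 1 := by
      rw [h, Matrix.add_apply, lowerForm_eq hJ]
      simp
    rw [hzero hkΔ, upperForm_eq] at h01
    rw [upperForm_eq]
    simp only [Matrix.of_apply, Matrix.cons_val_zero, Matrix.cons_val_one, Matrix.cons_val',
      Matrix.cons_val_fin_one] at h01
    rw [← h01]
    ext i j : 2
    fin_cases i <;> fin_cases j <;> simp

/-- Division of the first column by `∂^{m+1}`, which annihilates `P_m`. -/
theorem satisfiesII_of_preserves (hM : (M : Set 𝕜).Nonempty) {m n k : ℕ} (hmn : m ≤ n)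
    (hmk : m < k) (hk : k ≤ n) {T : MatOp M} (hT : MatOrderLE M k T)
    (hP : Preserves M m n T) : SatisfiesII M m n k T := by
  have hdiv : ∀ i, ∃ S R, T i 0 = S * D M ^ (m + 1) + R ∧ OrderLT M (k - m) S ∧
      OrderLT M (m + 1) R := fun i =>
    OrderLT.exists_eq_mul_D_pow_add (show OrderLT M (m + 1 + (k - m)) (T i 0) by
      rw [show m + 1 + (k - m) = k + 1 by lia]; exact hT i 0)
  choose s r hsr hs hr using hdiv
  have happ : ∀ i, ∀ f ∈ polySpace M m, r i f = T i 0 f := fun i f hf => by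
    rw [hsr i, LinearMap.add_apply, Module.End.mul_apply,
      D_pow_apply_polySpace (Nat.lt_succ_self m) hf, map_zero, zero_add]
  have hPR : Preserves M m n !![r 0, T 0 1; r 1, T 1 1] := by
    rw [preserves_iff] at hP ⊢
    refine ⟨fun f hf => ?_, hP.2⟩
    simpa [happ _ f hf] using hP.1 f hf
  have hR0 : ∀ i, OrderLE M m (!![r 0, T 0 1; r 1, T 1 1] i 0) := by
    intro i
    fin_cases i
    · exact hr 0
    · exact hr 1
  have hR1 : ∀ i, OrderLE M k (!![r 0, T 0 1; r 1, T 1 1] i 1) := by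
    intro i
    fin_cases i
    · exact hT 0 1
    · exact hT 1 1
  refine ⟨!![s 0, 0; s 1, 0], !![r 0, T 0 1; r 1, T 1 1], ?_, fun i => ?_, fun i => ?_, hR0, hR1,
    hPR, satisfiesI_of_preserves hM hmn hk (by rwa [min_eq_left hmk.le]) hR1 hPR⟩
  · ext i j : 2
    fin_cases i <;> fin_cases j <;> simp [matD, ← hsr]
  · have h : ∀ i, OrderLE M (k - m - 1) (s i) := fun i => (hs i).mono (by lia)
    fin_cases i
    · exact h 0
    · exact h 1
  · fin_cases i <;> rfl

end Functions

end PVSP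

theorem mainTheorem1 {𝕜 : Type*} [RCLike 𝕜] [NormedAlgebra 𝕜 ℂ]
    (M : TopologicalSpace.Opens 𝕜) (hM : (M : Set 𝕜).Nonempty)
    (m n k : ℕ) (hmn : m ≤ n) (T : PVSP.MatOp M)
    (hT : PVSP.MatOrderLE M k T) (hP : PVSP.Preserves M m n T) :
    (k ≤ m → PVSP.SatisfiesI M m n k T) ∧
    (m < k → k ≤ n → PVSP.SatisfiesII M m n k T) ∧
    (n < k → ∃ S R : PVSP.MatOp M, T = S * PVSP.matD M (n + 1) + R ∧
      PVSP.MatOrderLE M (k - n - 1) S ∧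
      (PVSP.MatOrderEq M k T → PVSP.MatOrderEq M (k - n - 1) S) ∧
      PVSP.MatOrderLE M n R ∧ PVSP.Preserves M m n R ∧
      ((n ≤ m ∧ PVSP.SatisfiesI M m n n R) ∨ (m < n ∧ PVSP.SatisfiesII M m n n R))) := by
  open PVSP in
  refine ⟨fun hk => ?_, fun hmk hk => satisfiesII_of_preserves hM hmn hmk hk hT hP, fun hk => ?_⟩
  · exact satisfiesI_of_preserves hM hmn (hk.trans hmn)
      (fun i => by rw [min_eq_right hk]; exact hT i 0) (fun i => hT i 1) hP
  have hdiv : ∀ i j, ∃ S R, T i j = S * D M ^ (n + 1) + R ∧ OrderLT M (k - n) S ∧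
      OrderLT M (n + 1) R := fun i j =>
    OrderLT.exists_eq_mul_D_pow_add (show OrderLT M (n + 1 + (k - n)) (T i j) by
      rw [show n + 1 + (k - n) = k + 1 by lia]; exact hT i j)
  choose S R hSR hS hR using hdiv
  have happ : ∀ i j, ∀ f ∈ polySpace M n, R i j f = T i j f := fun i j f hf => by
    rw [hSR i j, LinearMap.add_apply, Module.End.mul_apply,
      D_pow_apply_polySpace (Nat.lt_succ_self n) hf, map_zero, zero_add]
  have hsub : ∀ f ∈ polySpace M m, f ∈ polySpace M n := fun f hf => by
    rw [mem_polySpace] at hf ⊢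
    obtain ⟨P, hP, rfl⟩ := hf
    exact ⟨P, hP.trans hmn, rfl⟩
  have hPR : Preserves M m n (Matrix.of R) := by
    rw [preserves_iff] at hP ⊢
    refine ⟨fun f hf => ?_, fun f hf => ?_⟩
    · simpa [happ _ _ f (hsub f hf)] using hP.1 f hf
    · simpa [happ _ _ f hf] using hP.2 f hf
  have hSle : MatOrderLE M (k - n - 1) (Matrix.of S) := fun i j => (hS i j).mono (by lia)
  refine ⟨Matrix.of S, Matrix.of R, ?_, hSle, fun hTk => ⟨hSle, fun hlt => hTk.2 fun i j => ?_⟩,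
    hR, hPR, ?_⟩
  · ext i j : 2
    simp [matD, ← hSR]
  · -- If `S` had lower order, then so would `S ∂^{n+1} + R`, because `R` has order at most `n < k`.
    rw [hSR i j]
    exact (((hlt i j).mul_D_pow (n + 1)).mono (by lia)).add ((hR i j).mono (by lia))
  · rcases hmn.lt_or_eq with h | rfl
    · exact Or.inr ⟨h, satisfiesII_of_preserves hM hmn h le_rfl hR hPR⟩
    · exact Or.inl ⟨le_rfl, satisfiesI_of_preserves hM le_rfl le_rfl
        (fun i => by rw [min_self]; exact hR i 0) (fun i => hR i 1) hPR⟩
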